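/- Setting. Let $(V,E)$ be a finite directed graph. A distributed system $G$ over it has temporal states $x^{(k)}(t)\in\mathbb R^{n^{(k)}(t)}$ ($k\in V$), spatial states $x^{(ij)}(t)\in\mathbb R^{n^{(ij)}(t)}$ ($(i,j)\in E$), inputs $u^{(k)}(t)\in\mathbb R^{n_u^{(k)}(t)}$ and outputs $y^{(k)}(t)\in\mathbb R^{n_y^{(k)}(t)}$, $t\in\mathbb N_0$ (all dimensions may be $0$ and may vary), zero initial states, and $$\begin{bmatrix}x^{(k)}(t+1)\\ x^{(k)}_{\rm out}(t+1)\end{bmatrix}=A^{(k)}(t)\begin{bmatrix}x^{(k)}(t)\\ x^{(k)}_{\rm in}(t)\end{bmatrix}+B^{(k)}(t)u^{(k)}(t),\qquad y^{(k)}(t)=C^{(k)}(t)\begin{bmatrix}x^{(k)}(t)\\ x^{(k)}_{\rm in}(t)\end{bmatrix}+D^{(k)}(t)u^{(k)}(t),$$ where $x^{(k)}_{\rm in}$ stacks the $x^{(ik)}$ with $(i,k)\in E$, $x^{(k)}_{\rm out}$ stacks the $x^{(kj)}$ with $(k,j)\in E$, and $A,B,C,D$ are uniformly bounded in operator norm.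 The realization is balanced: there are $\beta>0$ and uniformly bounded diagonal matrices $\Sigma^{(k)}(t)\succ\beta I$, $\Sigma^{(ij)}(t)\succ\beta I$ such that, with $\Sigma^{\rm in}_k(t)=\mathrm{diag}\big(\Sigma^{(k)}(t),(\Sigma^{(ik)}(t))_{(i,k)\in E}\big)$ and $\Sigma^{\rm out}_k(t)=\mathrm{diag}\big(\Sigma^{(k)}(t),(\Sigma^{(kj)}(t))_{(k,j)\in E}\big)$, for all $t\in\mathbb N_0$, $k\in V$, $$A^{(k)}(t)\Sigma^{\rm in}_k(t)A^{(k)}(t)^T-\Sigma^{\rm out}_k(t+1)+B^{(k)}(t)B^{(k)}(t)^T\prec-\beta I,$$ $$A^{(k)}(t)^T\Sigma^{\rm out}_k(t+1)A^{(k)}(t)-\Sigma^{\rm in}_k(t)+C^{(k)}(t)^TC^{(k)}(t)\prec-\beta I.$$ Fix integers $0\le r^{(k)}(t)\le n^{(k)}(t)$ and $0\le r^{(ij)}(t)\le n^{(ij)}(t)$, and partition $\Sigma^{(k)}(t)=\mathrm{diag}(\Gamma^{(k)}(t),\Omega^{(k)}(t))$ with $\Gamma^{(k)}(t)$ of size $r^{(k)}(t)$,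 and likewise $\Sigma^{(ij)}(t)$. The reduced system $G_r$ is obtained by keeping, in $A,B,C$, only the rows and columns of the first $r^{(k)}(t)$, respectively $r^{(ij)}(t)$, entries of each state; $D$ is unchanged. Let $\mathcal F_k=\{t: n^{(k)}(t)\ne r^{(k)}(t)\}$ and $\mathcal F_{(ij)}=\{t: n^{(ij)}(t)\ne r^{(ij)}(t)\}$. For a map $T$ on input signals, $\|T\|=\sup_{0\ne u\in\ell_2}\|Tu\|_2/\|u\|_2$ is the $\ell_2$-induced norm. Theorem. Suppose that at least one of the sets $\mathcal F_k$, $\mathcal F_{(ij)}$ is non-empty, that $\Omega^{(k)}(t)=w^{(k)}(t)I$ for all $t\in\mathcal F_k$ and $\Omega^{(ij)}(t)=w^{(ij)}(t)I$ for all $t\in\mathcal F_{(ij)}$, and that each of the scalar sequences $w^{(k)}$ on $\mathcal F_k$ and $w^{(ij)}$ on $\mathcal F_{(ij)}$ is monotone (nondecreasing or nonincreasing). Then $$\|G-G_r\|<2\Big(\sum_{k\in V}\sup_{t\in\mathcal F_k}w^{(k)}(t)+\sum_{(i,j)\in E}\sup_{t\in\mathcal F_{(ij)}}w^{(ij)}(t)\Big),$$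 where the supremum over an empty set is $0$. Moreover, let $\zeta(\Omega)\in(0,\infty]$ be the sum of the distinct diagonal entries of all the blocks $\Omega^{(k)}(t)$, $\Omega^{(ij)}(t)$. If no value is taken by two different sequences among the $w^{(k)}|_{\mathcal F_k}$, $w^{(ij)}|_{\mathcal F_{(ij)}}$ (for instance, if only one state is truncated), then the right-hand side is at most $2\zeta(\Omega)$, and it is strictly smaller than $2\zeta(\Omega)$ if moreover at least one of the sequences is not constant. -/

import Mathlib

open scoped ENNReal

/-- The states of a distributed system over the directed graph with vertex set `V` and edge set `E`:
`Sum.inl k` is the temporal state of the vertex `k`, `Sum.inr (i, j)` is the spatial state of the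
edge from `i` to `j`. -/
abbrev Channel {V : Type*} (E : Finset (V × V)) : Type _ := V ⊕ E

namespace Channel

variable {V : Type*} {E : Finset (V × V)}

/-- The subsystem whose equations use the state at time `t`: the vertex `k` itself for the temporal
state of `k`, the head `j` for the edge `(i, j)`. -/
def reader : Channel E → V
  | Sum.inl k => k
  | Sum.inr e => e.1.2

/-- The subsystem whose equations produce the state at time `t + 1`: the vertex `k` itself for the
temporal state of `k`, the tail `i` for the edge `(i, j)`. -/
def writer : Channel E → V
  | Sum.inl k => k
  | Sum.inr e => e.1.1

end Channel

section Indices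

variable {V : Type*} {E : Finset (V × V)}

/-- Row index of the stacked vector of the temporal state of `k` and the spatial states of all edges
entering `k`, at time `t`. -/
abbrev InIdx (n : Channel E → ℕ → ℕ) (k : V) (t : ℕ) : Type _ :=
  Σ c : {c : Channel E // c.reader = k}, Fin (n c.1 t)

/-- Row index of the stacked vector of the temporal state of `k` and the spatial states of all edges
leaving `k`, at time `t`. -/
abbrev OutIdx (n : Channel E → ℕ → ℕ) (k : V) (t : ℕ) : Type _ :=
  Σ c : {c : Channel E // c.writer = k}, Fin (n c.1 t)

/-- One square matrix for each (temporal or spatial) state and each time. -/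
abbrev GramianFamily (n : Channel E → ℕ → ℕ) : Type _ :=
  ∀ (c : Channel E) (t : ℕ), Matrix (Fin (n c t)) (Fin (n c t)) ℝ

/-- Signals with values `w k t` in `ℝ ^ (m k t)`. -/
abbrev Signal (m : V → ℕ → ℕ) : Type _ := ∀ (k : V) (t : ℕ), Fin (m k t) → ℝ

end Indices

/-- A family of matrices is uniformly bounded if their operator norms, with respect to the Euclidean
norms, have a common bound. -/
def UniformlyBounded {ι : Type*} {p q : ι → Type*} [∀ i, Fintype (p i)] [∀ i, Fintype (q i)]
    (M : ∀ i, Matrix (p i) (q i) ℝ) : Prop :=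
  ∃ b : ℝ, ∀ (i : ι) (v : q i → ℝ),
    Matrix.mulVec (M i) v ⬝ᵥ Matrix.mulVec (M i) v ≤ b ^ 2 * (v ⬝ᵥ v)

/-- The realization `(A, B, C, D)` of a distributed system: `n` gives the dimensions of the temporal
and spatial states, `nu` and `ny` those of the inputs and outputs. -/
structure DistSystem {V : Type*} (E : Finset (V × V)) (n : Channel E → ℕ → ℕ)
    (nu ny : V → ℕ → ℕ) where
  A : ∀ (k : V) (t : ℕ), Matrix (OutIdx n k (t + 1)) (InIdx n k t) ℝ
  B : ∀ (k : V) (t : ℕ), Matrix (OutIdx n k (t + 1)) (Fin (nu k t)) ℝ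
  C : ∀ (k : V) (t : ℕ), Matrix (Fin (ny k t)) (InIdx n k t) ℝ
  D : ∀ (k : V) (t : ℕ), Matrix (Fin (ny k t)) (Fin (nu k t)) ℝ

section Blocks

variable {V : Type*} [DecidableEq V] {E : Finset (V × V)} {n : Channel E → ℕ → ℕ}

/-- The block-diagonal matrix of the blocks of `X` at the temporal state of `k` and at the edges
entering `k`. -/
def blockIn (X : GramianFamily n) (k : V) (t : ℕ) : Matrix (InIdx n k t) (InIdx n k t) ℝ :=
  Matrix.blockDiagonal' fun c : {c : Channel E // c.reader = k} => X c.1 t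

/-- The block-diagonal matrix of the blocks of `X` at the temporal state of `k` and at the edges
leaving `k`. -/
def blockOut (X : GramianFamily n) (k : V) (t : ℕ) : Matrix (OutIdx n k t) (OutIdx n k t) ℝ :=
  Matrix.blockDiagonal' fun c : {c : Channel E // c.writer = k} => X c.1 t

end Blocks

namespace DistSystem

section Dynamics

variable {V : Type*} [Fintype V] [DecidableEq V] {E : Finset (V × V)}
  {n : Channel E → ℕ → ℕ} {nu ny : V → ℕ → ℕ}

/-- The state-space matrices are uniformly bounded. -/
def IsUniformlyBounded (G : DistSystem E n nu ny) : Prop :=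
  UniformlyBounded (fun p : V × ℕ => G.A p.1 p.2) ∧
  UniformlyBounded (fun p : V × ℕ => G.B p.1 p.2) ∧
  UniformlyBounded (fun p : V × ℕ => G.C p.1 p.2) ∧
  UniformlyBounded (fun p : V × ℕ => G.D p.1 p.2)

/-- The state trajectory under the input `u`, with zero initial conditions. -/
def state (G : DistSystem E n nu ny) (u : Signal nu) :
    ∀ (t : ℕ) (c : Channel E), Fin (n c t) → ℝ
  | 0, _ => 0
  | t + 1, c => fun i =>
      (Matrix.mulVec (G.A c.writer t) (fun q : InIdx n c.writer t => G.state u t q.1.1 q.2) +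
        Matrix.mulVec (G.B c.writer t) (u c.writer t)) ⟨⟨c, rfl⟩, i⟩

/-- The input-output map of the system. -/
def output (G : DistSystem E n nu ny) (u : Signal nu) : Signal ny := fun k t =>
  Matrix.mulVec (G.C k t) (fun q : InIdx n k t => G.state u t q.1.1 q.2) +
    Matrix.mulVec (G.D k t) (u k t)

/-- The recursively defined state trajectory and output satisfy the state-space equations with zero
initial conditions, and they are the only solution. -/
theorem solution_iff (G : DistSystem E n nu ny) (u : Signal nu)
    (x : ∀ (t : ℕ) (c : Channel E), Fin (n c t) → ℝ) (y : Signal ny) :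
    ((∀ c, x 0 c = 0) ∧ ∀ k t,
      (fun q : OutIdx n k (t + 1) => x (t + 1) q.1.1 q.2) =
        Matrix.mulVec (G.A k t) (fun q : InIdx n k t => x t q.1.1 q.2) +
          Matrix.mulVec (G.B k t) (u k t) ∧
      y k t = Matrix.mulVec (G.C k t) (fun q : InIdx n k t => x t q.1.1 q.2) +
          Matrix.mulVec (G.D k t) (u k t)) ↔
    x = G.state u ∧ y = G.output u := by
  constructor
  · rintro ⟨h0, h⟩
    have hx : x = G.state u := by
      funext t
      induction t with
      | zero => funext c; rw [h0 c]; rfl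
      | succ t ih =>
        funext c i
        have := congrFun (h c.writer t).1 ⟨⟨c, rfl⟩, i⟩
        rw [ih] at this
        exact this
    refine ⟨hx, ?_⟩
    funext k t
    rw [(h k t).2, hx]
    rfl
  · rintro ⟨rfl, rfl⟩
    refine ⟨fun c => rfl, fun k t => ⟨?_, rfl⟩⟩
    funext q
    obtain ⟨⟨c, rfl⟩, i⟩ := q
    rfl

/-- `X` is a family of diagonal balanced generalized gramians of `G`: uniformly bounded, diagonal,
uniformly positive definite, and a solution of both generalized Lyapunov inequalities. Here
`P ≻ Q` is expressed as positive definiteness of `P - Q`. -/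
def IsBalancedGramian (G : DistSystem E n nu ny) (X : GramianFamily n) : Prop :=
  UniformlyBounded (fun p : Channel E × ℕ => X p.1 p.2) ∧
  (∀ c t, (X c t).IsDiag) ∧
  ∃ β : ℝ, 0 < β ∧
    (∀ c t, (X c t - β • (1 : Matrix (Fin (n c t)) (Fin (n c t)) ℝ)).PosDef) ∧
    (∀ k t, (-(β • (1 : Matrix (OutIdx n k (t + 1)) (OutIdx n k (t + 1)) ℝ)) -
      (G.A k t * blockIn X k t * (G.A k t).transpose - blockOut X k (t + 1) +
        G.B k t * (G.B k t).transpose)).PosDef) ∧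
    (∀ k t, (-(β • (1 : Matrix (InIdx n k t) (InIdx n k t) ℝ)) -
      ((G.A k t).transpose * blockOut X k (t + 1) * G.A k t - blockIn X k t +
        (G.C k t).transpose * G.C k t)).PosDef)

/-- The reduced order system: the first `r c t` entries of every state vector are kept. -/
def truncate (G : DistSystem E n nu ny) (r : Channel E → ℕ → ℕ) (hr : ∀ c t, r c t ≤ n c t) :
    DistSystem E r nu ny where
  A k t := (G.A k t).submatrix
    (fun q : OutIdx r k (t + 1) => ⟨q.1, Fin.castLE (hr q.1.1 (t + 1)) q.2⟩)
    (fun q : InIdx r k t => ⟨q.1, Fin.castLE (hr q.1.1 t) q.2⟩)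
  B k t := (G.B k t).submatrix
    (fun q : OutIdx r k (t + 1) => ⟨q.1, Fin.castLE (hr q.1.1 (t + 1)) q.2⟩) id
  C k t := (G.C k t).submatrix id
    (fun q : InIdx r k t => ⟨q.1, Fin.castLE (hr q.1.1 t) q.2⟩)
  D k t := G.D k t

end Dynamics

end DistSystem

section Truncation

variable {V : Type*} {E : Finset (V × V)} {n : Channel E → ℕ → ℕ}

/-- The block of the gramian `X c t` that belongs to the truncated entries, that is, to those of
index at least `r c t`. -/
def truncatedBlock (X : GramianFamily n) (r : Channel E → ℕ → ℕ) (c : Channel E) (t : ℕ) :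
    Matrix {i : Fin (n c t) // r c t ≤ i.val} {i : Fin (n c t) // r c t ≤ i.val} ℝ :=
  (X c t).submatrix Subtype.val Subtype.val

/-- The times at which some entry of the state `c` is truncated. -/
def truncationTimes (n r : Channel E → ℕ → ℕ) (c : Channel E) : Set ℕ := {t | n c t ≠ r c t}

/-- The set of all diagonal entries of the truncated blocks. -/
def truncatedEntries (X : GramianFamily n) (r : Channel E → ℕ → ℕ) : Set ℝ :=
  {q | ∃ c t i, truncatedBlock X r c t i i = q}

/-- The sum of the distinct diagonal entries of the truncated blocks (possibly infinite). -/
noncomputable def distinctEntriesSum (X : GramianFamily n) (r : Channel E → ℕ → ℕ) : ℝ≥0∞ :=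
  ∑' q : truncatedEntries X r, ENNReal.ofReal q

end Truncation

section Norms

variable {V : Type*}

/-- The `ℓ₂`-norm of a signal, infinite if the signal is not square summable. -/
noncomputable def l2Norm {m : V → ℕ → ℕ} (w : Signal m) : ℝ≥0∞ :=
  (∑' p : ℕ × V, ENNReal.ofReal (w p.2 p.1 ⬝ᵥ w p.2 p.1)) ^ (1 / 2 : ℝ)

/-- The `ℓ₂`-induced norm of a map between signals: the supremum of `‖T u‖ / ‖u‖` over the nonzero
`u` in `ℓ₂`. -/
noncomputable def inducedNorm {m p : V → ℕ → ℕ} (T : Signal m → Signal p) : ℝ≥0∞ :=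
  ⨆ (u : Signal m) (_ : u ≠ 0) (_ : l2Norm u < ∞), l2Norm (T u) / l2Norm u

end Norms

/-! ### Energy comparison of two trajectories with nested masks -/

section LyapunovRecursion

/-! Truncation is modelled on the full state space: the recursion of `G` is run and the discarded
entries are reset to zero at each step (`maskedState`). Every intermediate system then uses the
Lyapunov inequalities of `G` itself, and the states can be truncated one channel at a time.

For one channel, let `x` and `z` be the trajectories before and after its truncation. The
observability form `∑ σ (x - z)²` dissipates the output error, since the inputs cancel; the
controllability form `∑ (x + z)² / σ` is driven by `2u`. Add them with nonnegative, nonincreasing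
weights `a`, `b`. Resetting an entry of `z` does not increase the total if `b = a σ²` there
(`masked_coordinate_le`), and decreasing weights only help elsewhere. As `σ = w` on the truncated
block, `b / a = w²` is needed at truncation times, and monotonicity of `w` makes this possible
(`exists_antitone_weights`).

The result is an error of at most `2 √ρ sup w` per channel, and Minkowski's inequality adds up the
channels. The factor `ρ < 1` comes from the uniform slack `β` in the controllability inequality and
makes the final bound strict. -/

/-- The contribution of one coordinate to the Lyapunov function after masking. -/
theorem masked_coordinate_le {a b s X Z : ℝ} (ha : 0 ≤ a) (hb : 0 ≤ b) (hs : 0 < s) {m m' : Prop}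
    [Decidable m] [Decidable m'] (hm : m' → m) (hab : m → ¬ m' → b = a * s ^ 2) :
    a * (s * ((if m then X else 0) - (if m' then Z else 0)) ^ 2) +
        b * (((if m then X else 0) + (if m' then Z else 0)) ^ 2 / s) ≤
      a * (s * (X - Z) ^ 2) + b * ((X + Z) ^ 2 / s) := by
  by_cases h' : m'
  · simp [h', hm h']
  · by_cases h : m
    -- The entry is reset only in the second trajectory. Here `b / s = a s`, so the right side is `2
    -- a s (X² + Z²)` and the left side is `2 a s X²`.
    · rw [hab h h']
      simp only [h, h', if_true, if_false, sub_zero, add_zero]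
      have e : ∀ y : ℝ, a * s ^ 2 * (y / s) = a * s * y := fun y => by field_simp
      rw [e, e]
      nlinarith [mul_nonneg (mul_nonneg ha hs.le) (sq_nonneg Z)]
    · simp only [h, h', if_false]
      refine le_trans (b := 0) (by simp) (by positivity)

variable {I : ℕ → Type*} [∀ t, Fintype (I t)]

/-- Two trajectories with different masks, compared through a weighted sum of the quadratic forms of
their difference and of their sum. -/
theorem sum_mul_sq_error_le {σ : ∀ t, I t → ℝ} (hσ : ∀ t q, 0 < σ t q)
    {m m' : ∀ t, I t → Prop} [∀ t q, Decidable (m t q)] [∀ t q, Decidable (m' t q)]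
    (hm : ∀ t q, m' t q → m t q)
    {x z : ∀ t, I t → ℝ} {X Z : ∀ t, I (t + 1) → ℝ} (hx0 : x 0 = 0) (hz0 : z 0 = 0)
    (hx : ∀ t q, x (t + 1) q = if m (t + 1) q then X t q else 0)
    (hz : ∀ t q, z (t + 1) q = if m' (t + 1) q then Z t q else 0)
    {ε υ : ℕ → ℝ} {ρ : ℝ} (hρ : ρ ≤ 1)
    (hobs : ∀ t, ∑ q, σ (t + 1) q * (X t q - Z t q) ^ 2 + ε t ≤ ∑ q, σ t q * (x t q - z t q) ^ 2)
    (hctr : ∀ t, ∑ q, (X t q + Z t q) ^ 2 / σ (t + 1) q ≤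
      ρ * (∑ q, (x t q + z t q) ^ 2 / σ t q + 4 * υ t))
    {a b : ℕ → ℝ} (ha : Antitone a) (hb : Antitone b) (ha0 : ∀ t, 0 ≤ a t) (hb0 : ∀ t, 0 ≤ b t)
    (hab : ∀ t q, m t q → ¬ m' t q → b t = a t * σ t q ^ 2) (T : ℕ) :
    ∑ t ∈ Finset.range T, a (t + 1) * ε t ≤ 4 * ρ * ∑ t ∈ Finset.range T, b (t + 1) * υ t := by
  -- The stored energies at time `T` are kept on the left so that the induction closes.
  suffices h : a T * ∑ q, σ T q * (x T q - z T q) ^ 2 + b T * ∑ q, (x T q + z T q) ^ 2 / σ T q +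
      ∑ t ∈ Finset.range T, a (t + 1) * ε t ≤
        4 * ρ * ∑ t ∈ Finset.range T, b (t + 1) * υ t by
    have h1 : 0 ≤ a T * ∑ q, σ T q * (x T q - z T q) ^ 2 :=
      mul_nonneg (ha0 T) (Finset.sum_nonneg fun q _ => mul_nonneg (hσ T q).le (sq_nonneg _))
    have h2 : 0 ≤ b T * ∑ q, (x T q + z T q) ^ 2 / σ T q :=
      mul_nonneg (hb0 T) (Finset.sum_nonneg fun q _ => div_nonneg (sq_nonneg _) (hσ T q).le)
    linarith
  induction T with
  | zero => simp [hx0, hz0]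
  | succ t ih =>
    rw [Finset.sum_range_succ, Finset.sum_range_succ]
    have step : a (t + 1) * ∑ q, σ (t + 1) q * (x (t + 1) q - z (t + 1) q) ^ 2 +
        b (t + 1) * ∑ q, (x (t + 1) q + z (t + 1) q) ^ 2 / σ (t + 1) q ≤
        a (t + 1) * ∑ q, σ (t + 1) q * (X t q - Z t q) ^ 2 +
        b (t + 1) * ∑ q, (X t q + Z t q) ^ 2 / σ (t + 1) q := by
      simp only [Finset.mul_sum, ← Finset.sum_add_distrib]
      refine Finset.sum_le_sum fun q _ => ?_
      rw [hx, hz]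
      exact masked_coordinate_le (ha0 _) (hb0 _) (hσ _ _) (hm _ _) (hab _ _)
    have hP : 0 ≤ ∑ q, σ t q * (x t q - z t q) ^ 2 :=
      Finset.sum_nonneg fun q _ => mul_nonneg (hσ t q).le (sq_nonneg _)
    have hQ : 0 ≤ ∑ q, (x t q + z t q) ^ 2 / σ t q :=
      Finset.sum_nonneg fun q _ => div_nonneg (sq_nonneg _) (hσ t q).le
    have h1 := mul_le_mul_of_nonneg_left (hobs t) (ha0 (t + 1))
    have h2 := mul_le_mul_of_nonneg_left (hctr t) (hb0 (t + 1))
    have h3 := mul_le_mul_of_nonneg_right (ha (Nat.le_succ t)) hP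
    have h4 := mul_le_mul_of_nonneg_right (hb (Nat.le_succ t)) hQ
    -- The factor `ρ` is given up on the stored energy and retained only on the input.
    have h5 := mul_nonneg (mul_nonneg (hb0 (t + 1)) hQ) (sub_nonneg.2 hρ)
    simp only [Nat.succ_eq_add_one] at h3 h4
    linarith

end LyapunovRecursion

/-! ### Nonincreasing weights with prescribed ratio -/

section Weights

/-- A monotone or antitone sequence on a set of times yields a pair of nonincreasing weights whose
ratio on that set is the square of the sequence. -/
theorem exists_antitone_weights {F : Set ℕ} {w : ℕ → ℝ} (hw : MonotoneOn w F ∨ AntitoneOn w F)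
    {β W : ℝ} (hβ : 0 < β) (hβW : β ≤ W) (hl : ∀ t ∈ F, β ≤ w t) (hu : ∀ t ∈ F, w t ≤ W) :
    ∃ (a b : ℕ → ℝ) (a₀ : ℝ), 0 < a₀ ∧ Antitone a ∧ Antitone b ∧ (∀ t, a₀ ≤ a t) ∧
      (∀ t, 0 ≤ b t) ∧ (∀ t, b t ≤ a₀ * W ^ 2) ∧ ∀ t ∈ F, b t = a t * w t ^ 2 := by
  have hlb : BddBelow (w '' F) := ⟨β, by rintro _ ⟨t, ht, rfl⟩; exact hl t ht⟩
  have hub : BddAbove (w '' F) := ⟨W, by rintro _ ⟨t, ht, rfl⟩; exact hu t ht⟩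
  have hW : 0 < W := hβ.trans_le hβW
  -- Clamping an extension of `w` to `[β, W]` bounds it at all times and changes nothing on `F`.
  have hpos : ∀ g : ℕ → ℝ, ∀ t, 0 < max β (min (g t) W) := fun g t => lt_max_of_lt_left hβ
  have hle : ∀ g : ℕ → ℝ, ∀ t, max β (min (g t) W) ≤ W :=
    fun g t => max_le hβW (min_le_right _ _)
  rcases hw with hw | hw
  -- Nondecreasing `w`: take `a = w⁻²` and `b = 1`, so `a ≥ W⁻²`.
  · obtain ⟨g, hg, hgw⟩ := hw.exists_monotone_extension hlb hub
    refine ⟨fun t => (max β (min (g t) W) ^ 2)⁻¹, fun _ => 1, (W ^ 2)⁻¹, by positivity, ?_,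
      antitone_const, ?_, fun _ => zero_le_one, fun _ => ?_, ?_⟩
    · intro s t hst
      have := hpos g s
      have := hg hst
      dsimp only
      gcongr
    · intro t
      have := hpos g t
      have := hle g t
      dsimp only
      gcongr
    · rw [inv_mul_cancel₀ (by positivity)]
    · intro t ht
      have h1 := hl t ht
      have h2 := hu t ht
      have h3 : w t ≠ 0 := (hβ.trans_le h1).ne'
      dsimp only
      rw [← hgw ht] at *
      rw [min_eq_left h2, max_eq_right h1, inv_mul_cancel₀ (by positivity)]
  -- Nonincreasing `w`: take `a = 1` and `b = w²`.
  · obtain ⟨g, hg, hgw⟩ := hw.exists_antitone_extension hlb hub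
    refine ⟨fun _ => 1, fun t => max β (min (g t) W) ^ 2, 1, one_pos, antitone_const, ?_,
      fun _ => le_rfl, fun _ => by positivity, ?_, ?_⟩
    · intro s t hst
      have := hpos g t
      have := hg hst
      dsimp only
      gcongr
    · intro t
      have := hpos g t
      have := hle g t
      dsimp only
      rw [one_mul]
      gcongr
    · intro t ht
      have h1 := hl t ht
      have h2 := hu t ht
      dsimp only
      rw [← hgw ht] at *
      rw [min_eq_left h2, max_eq_right h1, one_mul]

end Weights

/-! ### From matrix inequalities to dissipation inequalities -/

section MatrixInequalities

variable {p q s : Type*} [Fintype p] [Fintype q] [Fintype s] [DecidableEq p] [DecidableEq q]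

/-- The observability inequality as a dissipation inequality. -/
theorem sum_sq_mulVec_le_of_posDef {A : Matrix p q ℝ} {C : Matrix s q ℝ} {σ : q → ℝ} {τ : p → ℝ}
    {β : ℝ} (hβ : 0 ≤ β)
    (h : (-(β • (1 : Matrix q q ℝ)) - (A.transpose * Matrix.diagonal τ * A - Matrix.diagonal σ +
      C.transpose * C)).PosDef) (x : q → ℝ) :
    ∑ i, τ i * (A.mulVec x i) ^ 2 + C.mulVec x ⬝ᵥ C.mulVec x ≤ ∑ j, σ j * x j ^ 2 := by
  have h0 := h.posSemidef.dotProduct_mulVec_nonneg x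
  have e1 : x ⬝ᵥ (A.transpose * Matrix.diagonal τ * A).mulVec x =
      ∑ i, τ i * (A.mulVec x i) ^ 2 := by
    rw [← Matrix.mulVec_mulVec, ← Matrix.mulVec_mulVec, Matrix.dotProduct_mulVec,
      Matrix.vecMul_transpose]
    simp only [dotProduct, Matrix.mulVec_diagonal]
    exact Finset.sum_congr rfl fun i _ => by ring
  have e2 : x ⬝ᵥ (C.transpose * C).mulVec x = C.mulVec x ⬝ᵥ C.mulVec x := by
    rw [← Matrix.mulVec_mulVec, Matrix.dotProduct_mulVec, Matrix.vecMul_transpose]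
  have e3 : x ⬝ᵥ (Matrix.diagonal σ).mulVec x = ∑ j, σ j * x j ^ 2 := by
    simp only [dotProduct, Matrix.mulVec_diagonal]
    exact Finset.sum_congr rfl fun i _ => by ring
  have e4 : 0 ≤ x ⬝ᵥ x := Finset.sum_nonneg fun i _ => mul_self_nonneg _
  simp only [star_trivial, Matrix.sub_mulVec, Matrix.neg_mulVec, Matrix.add_mulVec,
    Matrix.smul_mulVec, Matrix.one_mulVec, dotProduct_sub, dotProduct_neg, dotProduct_add,
    dotProduct_smul, e1, e2, e3, smul_eq_mul] at h0
  nlinarith [mul_nonneg hβ e4]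

/-- The controllability inequality as a strict contraction. -/
theorem sum_sq_mulVec_div_le_of_posDef {A : Matrix p q ℝ} {B : Matrix p s ℝ} {σ : q → ℝ}
    {τ : p → ℝ} (hσ : ∀ j, 0 < σ j) (hτ : ∀ i, 0 < τ i) {β ρ : ℝ} (hρ : 0 < ρ)
    (hτβ : ∀ i, τ i - β ≤ ρ * τ i)
    (h : (-(β • (1 : Matrix p p ℝ)) - (A * Matrix.diagonal σ * A.transpose - Matrix.diagonal τ +
      B * B.transpose)).PosDef) (x : q → ℝ) (v : s → ℝ) :
    ∑ i, (A.mulVec x i + B.mulVec v i) ^ 2 / τ i ≤ ρ * (∑ j, x j ^ 2 / σ j + v ⬝ᵥ v) := by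
  -- The controllability inequality concerns the transposes, so it is tested on the dual vector `f =
  -- τ⁻¹ (A x + B v)`; its pairing with `A x + B v` is the quantity to be bounded.
  set f : p → ℝ := fun i => (A.mulVec x i + B.mulVec v i) / τ i with hf
  have h0 := h.posSemidef.dotProduct_mulVec_nonneg f
  have e1 : f ⬝ᵥ (A * Matrix.diagonal σ * A.transpose).mulVec f =
      ∑ j, σ j * (A.transpose.mulVec f j) ^ 2 := by
    rw [← Matrix.mulVec_mulVec, ← Matrix.mulVec_mulVec, Matrix.dotProduct_mulVec,
      ← Matrix.mulVec_transpose]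
    simp only [dotProduct, Matrix.mulVec_diagonal]
    exact Finset.sum_congr rfl fun i _ => by ring
  have e2 : f ⬝ᵥ (B * B.transpose).mulVec f = ∑ l, (B.transpose.mulVec f l) ^ 2 := by
    rw [← Matrix.mulVec_mulVec, Matrix.dotProduct_mulVec, ← Matrix.mulVec_transpose]
    simp only [dotProduct]
    exact Finset.sum_congr rfl fun i _ => by ring
  have e3 : f ⬝ᵥ (Matrix.diagonal τ).mulVec f = ∑ i, τ i * f i ^ 2 := by
    simp only [dotProduct, Matrix.mulVec_diagonal]
    exact Finset.sum_congr rfl fun i _ => by ring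
  have e4 : f ⬝ᵥ f = ∑ i, f i ^ 2 := Finset.sum_congr rfl fun i _ => by ring
  simp only [star_trivial, Matrix.sub_mulVec, Matrix.neg_mulVec, Matrix.add_mulVec,
    Matrix.smul_mulVec, Matrix.one_mulVec, dotProduct_sub, dotProduct_neg, dotProduct_add,
    dotProduct_smul, e1, e2, e3, e4, smul_eq_mul] at h0
  have hQ : ∑ i, (A.mulVec x i + B.mulVec v i) ^ 2 / τ i = ∑ i, τ i * f i ^ 2 := by
    refine Finset.sum_congr rfl fun i _ => ?_
    have := (hτ i).ne'
    simp only [hf]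
    field_simp
  have hQ' : ∑ i, τ i * f i ^ 2 =
      ∑ j, A.transpose.mulVec f j * x j + ∑ l, B.transpose.mulVec f l * v l := by
    have h1 : f ⬝ᵥ A.mulVec x = ∑ j, A.transpose.mulVec f j * x j := by
      rw [Matrix.dotProduct_mulVec, ← Matrix.mulVec_transpose]; rfl
    have h2 : f ⬝ᵥ B.mulVec v = ∑ l, B.transpose.mulVec f l * v l := by
      rw [Matrix.dotProduct_mulVec, ← Matrix.mulVec_transpose]; rfl
    rw [← h1, ← h2, ← dotProduct_add]
    refine Finset.sum_congr rfl fun i _ => ?_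
    have := (hτ i).ne'
    simp only [hf, Pi.add_apply]
    field_simp
  have hmain : ∑ i, τ i * f i ^ 2 - β * ∑ i, f i ^ 2 ≤ ρ * ∑ i, τ i * f i ^ 2 := by
    rw [Finset.mul_sum, Finset.mul_sum, ← Finset.sum_sub_distrib]
    refine Finset.sum_le_sum fun i _ => ?_
    nlinarith [mul_le_mul_of_nonneg_right (hτβ i) (sq_nonneg (f i))]
  -- Young's inequality with parameter `ρ`: its quadratic terms in `f` are absorbed by `h0` and
  -- `hmain`, at the cost of `ρ` times the target.
  have y1 : 2 * ρ * ∑ j, A.transpose.mulVec f j * x j ≤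
      ∑ j, σ j * (A.transpose.mulVec f j) ^ 2 + ρ ^ 2 * ∑ j, x j ^ 2 / σ j := by
    rw [Finset.mul_sum, Finset.mul_sum, ← Finset.sum_add_distrib]
    refine Finset.sum_le_sum fun j _ => ?_
    have hj := hσ j
    have : 0 ≤ σ j * (A.transpose.mulVec f j - ρ * (x j / σ j)) ^ 2 := by positivity
    have e : σ j * (A.transpose.mulVec f j - ρ * (x j / σ j)) ^ 2 =
        σ j * (A.transpose.mulVec f j) ^ 2 + ρ ^ 2 * (x j ^ 2 / σ j) -
          2 * ρ * (A.transpose.mulVec f j * x j) := by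
      field_simp
      ring
    linarith
  have y2 : 2 * ρ * ∑ l, B.transpose.mulVec f l * v l ≤
      ∑ l, (B.transpose.mulVec f l) ^ 2 + ρ ^ 2 * (v ⬝ᵥ v) := by
    rw [dotProduct, Finset.mul_sum, Finset.mul_sum, ← Finset.sum_add_distrib]
    refine Finset.sum_le_sum fun l _ => ?_
    nlinarith [sq_nonneg (B.transpose.mulVec f l - ρ * v l)]
  rw [hQ]
  refine le_of_mul_le_mul_left (?_ : ρ * _ ≤ ρ * _) hρ
  have : 2 * ρ * ∑ i, τ i * f i ^ 2 ≤ ρ * ∑ i, τ i * f i ^ 2 +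
      ρ ^ 2 * (∑ j, x j ^ 2 / σ j + v ⬝ᵥ v) := by
    have y := add_le_add y1 y2
    rw [← mul_add, ← hQ'] at y
    linarith
  linarith

end MatrixInequalities

/-! ### Gramians as diagonal weights -/

section GramianDiag

variable {V : Type*} [DecidableEq V] {E : Finset (V × V)} {n : Channel E → ℕ → ℕ}

/-- Row index of the stacked vector of all temporal and spatial states at time `t`. -/
abbrev StateIdx (n : Channel E → ℕ → ℕ) (t : ℕ) : Type _ := Σ c : Channel E, Fin (n c t)

/-- The diagonal entries of a family of gramians. -/
def gramianDiag (X : GramianFamily n) (t : ℕ) (q : StateIdx n t) : ℝ := X q.1 t q.2 q.2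

theorem blockIn_eq_diagonal {X : GramianFamily n} (hX : ∀ c t, (X c t).IsDiag) (k : V) (t : ℕ) :
    blockIn X k t = Matrix.diagonal fun q => gramianDiag X t ⟨q.1.1, q.2⟩ := by
  unfold blockIn gramianDiag
  conv_lhs =>
    enter [1, c]
    rw [← (hX c.1 t).diagonal_diag]
  exact Matrix.blockDiagonal'_diagonal _

theorem blockOut_eq_diagonal {X : GramianFamily n} (hX : ∀ c t, (X c t).IsDiag) (k : V) (t : ℕ) :
    blockOut X k t = Matrix.diagonal fun q => gramianDiag X t ⟨q.1.1, q.2⟩ := by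
  unfold blockOut gramianDiag
  conv_lhs =>
    enter [1, c]
    rw [← (hX c.1 t).diagonal_diag]
  exact Matrix.blockDiagonal'_diagonal _

end GramianDiag

/-! ### The stacked system and its masked trajectories -/

section GlobalState

variable {V : Type*} [Fintype V] [DecidableEq V] {E : Finset (V × V)}
  {n : Channel E → ℕ → ℕ} {nu ny : V → ℕ → ℕ}

/-- Each channel has exactly one reader. Together with the analogue for writers, this lets the
inequalities of the subsystems add up to one global energy balance. -/
theorem sum_inIdx (t : ℕ) (f : StateIdx n t → ℝ) :
    ∑ k, ∑ q : InIdx n k t, f ⟨q.1.1, q.2⟩ = ∑ p, f p := by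
  rw [Fintype.sum_sigma f, ← Fintype.sum_fiberwise Channel.reader]
  exact Finset.sum_congr rfl fun k _ => Fintype.sum_sigma _

theorem sum_outIdx (t : ℕ) (f : StateIdx n t → ℝ) :
    ∑ k, ∑ q : OutIdx n k t, f ⟨q.1.1, q.2⟩ = ∑ p, f p := by
  rw [Fintype.sum_sigma f, ← Fintype.sum_fiberwise Channel.writer]
  exact Finset.sum_congr rfl fun k _ => Fintype.sum_sigma _

namespace DistSystem

/-- The right-hand sides of all state equations. -/
def next (G : DistSystem E n nu ny) (t : ℕ) (x : StateIdx n t → ℝ)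
    (v : ∀ k, Fin (nu k t) → ℝ) : StateIdx n (t + 1) → ℝ := fun p =>
  (Matrix.mulVec (G.A p.1.writer t) (fun q : InIdx n p.1.writer t => x ⟨q.1.1, q.2⟩) +
    Matrix.mulVec (G.B p.1.writer t) (v p.1.writer)) ⟨⟨p.1, rfl⟩, p.2⟩

theorem next_outIdx (G : DistSystem E n nu ny) (t : ℕ) (x : StateIdx n t → ℝ)
    (v : ∀ k, Fin (nu k t) → ℝ) (k : V) (p : OutIdx n k (t + 1)) :
    G.next t x v ⟨p.1.1, p.2⟩ =
      Matrix.mulVec (G.A k t) (fun q : InIdx n k t => x ⟨q.1.1, q.2⟩) p +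
        Matrix.mulVec (G.B k t) (v k) p := by
  obtain ⟨⟨c, rfl⟩, i⟩ := p
  rfl

theorem next_sub (G : DistSystem E n nu ny) (t : ℕ) (x z : StateIdx n t → ℝ)
    (v v' : ∀ k, Fin (nu k t) → ℝ) :
    G.next t x v - G.next t z v' = G.next t (x - z) (v - v') := by
  funext p
  have h := congrFun (Matrix.mulVec_sub (G.A p.1.writer t)
    (fun q : InIdx n p.1.writer t => x ⟨q.1.1, q.2⟩) fun q => z ⟨q.1.1, q.2⟩) ⟨⟨p.1, rfl⟩, p.2⟩
  simp only [next, Pi.sub_apply, Pi.add_apply, Matrix.mulVec_sub]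
  refine Eq.trans ?_ (congrArg (· + _) h.symm)
  rw [Pi.sub_apply]
  ring

theorem next_add (G : DistSystem E n nu ny) (t : ℕ) (x z : StateIdx n t → ℝ)
    (v v' : ∀ k, Fin (nu k t) → ℝ) :
    G.next t x v + G.next t z v' = G.next t (x + z) (v + v') := by
  funext p
  have h := congrFun (Matrix.mulVec_add (G.A p.1.writer t)
    (fun q : InIdx n p.1.writer t => x ⟨q.1.1, q.2⟩) fun q => z ⟨q.1.1, q.2⟩) ⟨⟨p.1, rfl⟩, p.2⟩
  simp only [next, Pi.add_apply, Matrix.mulVec_add]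
  refine Eq.trans ?_ (congrArg (· + _) h.symm)
  rw [Pi.add_apply]
  ring

/-- The output equation of the subsystem `k`, without the feedthrough term. -/
def readout (G : DistSystem E n nu ny) (t : ℕ) (x : StateIdx n t → ℝ) (k : V) :
    Fin (ny k t) → ℝ :=
  Matrix.mulVec (G.C k t) fun q : InIdx n k t => x ⟨q.1.1, q.2⟩

theorem readout_sub (G : DistSystem E n nu ny) (t : ℕ) (x z : StateIdx n t → ℝ) (k : V) :
    G.readout t (x - z) k = G.readout t x k - G.readout t z k :=
  Matrix.mulVec_sub (G.C k t) (fun q : InIdx n k t => x ⟨q.1.1, q.2⟩) fun q => z ⟨q.1.1, q.2⟩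

/-- The state trajectory if the entries outside of `m` are reset to zero at each time. -/
def maskedState (G : DistSystem E n nu ny) (m : ∀ t, StateIdx n t → Prop)
    [∀ t q, Decidable (m t q)] (u : Signal nu) : ∀ t, StateIdx n t → ℝ
  | 0 => 0
  | t + 1 => fun q => if m (t + 1) q then G.next t (G.maskedState m u t) (fun k => u k t) q else 0

theorem maskedState_succ (G : DistSystem E n nu ny) (m : ∀ t, StateIdx n t → Prop)
    [∀ t q, Decidable (m t q)] (u : Signal nu) (t : ℕ) (q : StateIdx n (t + 1)) :
    G.maskedState m u (t + 1) q =
      if m (t + 1) q then G.next t (G.maskedState m u t) (fun k => u k t) q else 0 := rfl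

theorem maskedState_eq_state (G : DistSystem E n nu ny) (m : ∀ t, StateIdx n t → Prop)
    [∀ t q, Decidable (m t q)] (hm : ∀ t q, m t q) (u : Signal nu) (t : ℕ) (q : StateIdx n t) :
    G.maskedState m u t q = G.state u t q.1 q.2 := by
  induction t with
  | zero => rfl
  | succ t ih =>
    rw [maskedState_succ, if_pos (hm _ _), funext ih]
    rfl

/-- Extension by zero of a vector of kept entries. -/
theorem sum_zeroExtend_inIdx {r : Channel E → ℕ → ℕ} (hr : ∀ c t, r c t ≤ n c t) (k : V) (t : ℕ)
    (f : InIdx n k t → ℝ) (x : ∀ c, Fin (r c t) → ℝ) (y : ∀ c, Fin (n c t) → ℝ)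
    (hy : ∀ c i, y c (Fin.castLE (hr c t) i) = x c i)
    (hy0 : ∀ c i, r c t ≤ i.val → y c i = 0) :
    ∑ q : InIdx r k t, f ⟨q.1, Fin.castLE (hr q.1.1 t) q.2⟩ * x q.1.1 q.2 =
      ∑ q : InIdx n k t, f q * y q.1.1 q.2 := by
  refine Fintype.sum_of_injective
    (fun q : InIdx r k t => (⟨q.1, Fin.castLE (hr q.1.1 t) q.2⟩ : InIdx n k t)) ?_ _ _ ?_ ?_
  · rintro ⟨c, i⟩ ⟨c', i'⟩ h
    obtain rfl : c = c' := congrArg Sigma.fst h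
    simpa using h
  · rintro ⟨c, i⟩ h
    rw [hy0, mul_zero]
    by_contra! hi
    exact h ⟨⟨c, ⟨i.1, hi⟩⟩, rfl⟩
  · intro q
    rw [hy]

/-- Entries reset to zero contribute nothing to the next step, so deleting rows and columns amounts
to masking. -/
theorem maskedState_eq_truncate_state (G : DistSystem E n nu ny) {r : Channel E → ℕ → ℕ}
    (hr : ∀ c t, r c t ≤ n c t) (m : ∀ t, StateIdx n t → Prop) [∀ t q, Decidable (m t q)]
    (hm : ∀ t q, m t q ↔ q.2.val < r q.1 t) (u : Signal nu) (t : ℕ) (c : Channel E) :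
    (∀ i, G.maskedState m u t ⟨c, Fin.castLE (hr c t) i⟩ = (G.truncate r hr).state u t c i) ∧
      ∀ i : Fin (n c t), r c t ≤ i.val → G.maskedState m u t ⟨c, i⟩ = 0 := by
  induction t generalizing c with
  | zero => exact ⟨fun i => rfl, fun i _ => rfl⟩
  | succ t ih =>
    refine ⟨fun i => ?_, fun i hi => ?_⟩
    · rw [maskedState_succ, if_pos ((hm _ _).2 i.2)]
      simp only [next, state, Pi.add_apply]
      congr 1
      exact (sum_zeroExtend_inIdx hr c.writer t
        (G.A c.writer t ⟨⟨c, rfl⟩, Fin.castLE (hr c (t + 1)) i⟩) _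
        (fun c i => G.maskedState m u t ⟨c, i⟩) (fun c i => (ih c).1 i) (fun c => (ih c).2)).symm
    · rw [maskedState_succ, if_neg]
      exact fun h => not_lt.2 hi ((hm _ ⟨c, i⟩).1 h)

theorem output_eq (G : DistSystem E n nu ny) (m : ∀ t, StateIdx n t → Prop)
    [∀ t q, Decidable (m t q)] (hm : ∀ t q, m t q) (u : Signal nu) (k : V) (t : ℕ) :
    G.output u k t = G.readout t (G.maskedState m u t) k + Matrix.mulVec (G.D k t) (u k t) := by
  rw [funext (G.maskedState_eq_state m hm u t)]
  rfl

theorem truncate_output_eq (G : DistSystem E n nu ny) {r : Channel E → ℕ → ℕ}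
    (hr : ∀ c t, r c t ≤ n c t) (m : ∀ t, StateIdx n t → Prop) [∀ t q, Decidable (m t q)]
    (hm : ∀ t q, m t q ↔ q.2.val < r q.1 t) (u : Signal nu) (k : V) (t : ℕ) :
    (G.truncate r hr).output u k t =
      G.readout t (G.maskedState m u t) k + Matrix.mulVec (G.D k t) (u k t) := by
  have h := G.maskedState_eq_truncate_state hr m hm u t
  rw [output]
  congr 1
  funext i
  exact sum_zeroExtend_inIdx hr k t (G.C k t i) _ (fun c i => G.maskedState m u t ⟨c, i⟩)
    (fun c => (h c).1) (fun c => (h c).2)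

/-- Bounds and dissipation inequalities of the stacked system that follow from a family of balanced
gramians. -/
theorem IsBalancedGramian.exists_dissipation {G : DistSystem E n nu ny} {X : GramianFamily n}
    (hX : G.IsBalancedGramian X) :
    ∃ β M ρ : ℝ, 0 < β ∧ 0 ≤ ρ ∧ ρ < 1 ∧ (∀ t q, β ≤ gramianDiag X t q) ∧
      (∀ t q, gramianDiag X t q ≤ M) ∧
      (∀ t (x : StateIdx n t → ℝ),
        ∑ q, gramianDiag X (t + 1) q * (G.next t x 0 q) ^ 2 +
            ∑ k, G.readout t x k ⬝ᵥ G.readout t x k ≤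
          ∑ q, gramianDiag X t q * x q ^ 2) ∧
      ∀ t (x : StateIdx n t → ℝ) (v : ∀ k, Fin (nu k t) → ℝ),
        ∑ q, (G.next t x v q) ^ 2 / gramianDiag X (t + 1) q ≤
          ρ * (∑ q, x q ^ 2 / gramianDiag X t q + ∑ k, v k ⬝ᵥ v k) := by
  obtain ⟨⟨b, hb⟩, hdiag, β, hβ, hpd, hctr, hobs⟩ := hX
  have hlow : ∀ t q, β ≤ gramianDiag X t q := by
    rintro t ⟨c, i⟩
    have := (hpd c t).diag_pos (i := i)
    simp only [Matrix.sub_apply, Matrix.smul_apply, Matrix.one_apply_eq, smul_eq_mul,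
      mul_one] at this
    exact (sub_pos.1 this).le
  have hpos : ∀ t q, 0 < gramianDiag X t q := fun t q => hβ.trans_le (hlow t q)
  have hup : ∀ t q, gramianDiag X t q ≤ |b| := by
    rintro t ⟨c, i⟩
    have h := hb (c, t) (Pi.single i 1)
    simp only [Matrix.mulVec_single_one, single_one_dotProduct, Pi.single_eq_same, mul_one] at h
    have h' : X c t i i * X c t i i ≤ (X c t).col i ⬝ᵥ (X c t).col i :=
      Finset.single_le_sum (f := fun j => X c t j i * X c t j i)
        (fun j _ => mul_self_nonneg _) (Finset.mem_univ i)
    refine (le_abs_self _).trans (sq_le_sq.1 ?_)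
    rw [sq]
    exact h'.trans h
  -- Since `σ ≤ |b|`, this `ρ` satisfies `σ - β ≤ ρ σ`. The summand `2 * β` keeps `ρ` positive even
  -- if there are no states and `b = 0`.
  have hρ : 0 < 1 - β / (|b| + 2 * β) := by
    rw [sub_pos, div_lt_one (by positivity)]
    linarith [abs_nonneg b]
  refine ⟨β, |b|, 1 - β / (|b| + 2 * β), hβ, hρ.le, sub_lt_self _ (by positivity), hlow, hup,
    fun t x => ?_, fun t x v => ?_⟩
  · rw [← sum_outIdx, ← sum_inIdx, ← Finset.sum_add_distrib]
    refine Finset.sum_le_sum fun k _ => ?_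
    have h := hobs k t
    rw [blockIn_eq_diagonal hdiag, blockOut_eq_diagonal hdiag] at h
    have h' := sum_sq_mulVec_le_of_posDef hβ.le h fun q => x ⟨q.1.1, q.2⟩
    simpa only [readout, next_outIdx, Pi.zero_apply, Matrix.mulVec_zero, add_zero] using h'
  · rw [← sum_outIdx, ← sum_inIdx, ← Finset.sum_add_distrib, Finset.mul_sum]
    refine Finset.sum_le_sum fun k _ => ?_
    have h := hctr k t
    rw [blockIn_eq_diagonal hdiag, blockOut_eq_diagonal hdiag] at h
    have hτ : ∀ q, gramianDiag X (t + 1) q - β ≤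
        (1 - β / (|b| + 2 * β)) * gramianDiag X (t + 1) q := by
      intro q
      have h1 := hup (t + 1) q
      have h2 : gramianDiag X (t + 1) q / (|b| + 2 * β) ≤ 1 := by
        rw [div_le_one (by positivity)]
        linarith
      have h3 : (1 - β / (|b| + 2 * β)) * gramianDiag X (t + 1) q =
          gramianDiag X (t + 1) q - β * (gramianDiag X (t + 1) q / (|b| + 2 * β)) := by ring
      rw [h3]
      nlinarith
    have h' := sum_sq_mulVec_div_le_of_posDef (fun q : InIdx n k t => hpos t ⟨q.1.1, q.2⟩)
      (fun q : OutIdx n k (t + 1) => hpos (t + 1) ⟨q.1.1, q.2⟩) hρ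
      (fun q : OutIdx n k (t + 1) => hτ ⟨q.1.1, q.2⟩) h (fun q => x ⟨q.1.1, q.2⟩) (v k)
    simpa only [next_outIdx] using h'

end DistSystem

end GlobalState

/-! ### Finite-horizon norms -/

section FiniteHorizon

variable {V : Type*} [Fintype V] {m p : V → ℕ → ℕ}

/-- The squared norm of the restriction of a signal to the times before `T`. -/
def horizonSqNorm (T : ℕ) (e : Signal m) : ℝ := ∑ t ∈ Finset.range T, ∑ k, e k t ⬝ᵥ e k t

theorem horizonSqNorm_nonneg (T : ℕ) (e : Signal m) : 0 ≤ horizonSqNorm T e :=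
  Finset.sum_nonneg fun _ _ => Finset.sum_nonneg fun _ _ =>
    Finset.sum_nonneg fun _ _ => mul_self_nonneg _

theorem horizonSqNorm_eq_sum (T : ℕ) (e : Signal m) :
    horizonSqNorm T e = ∑ q ∈ (Finset.range T).sigma
      (fun t => (Finset.univ : Finset (Σ k, Fin (m k t)))), e q.2.1 q.1 q.2.2 ^ 2 := by
  rw [horizonSqNorm, Finset.sum_sigma]
  refine Finset.sum_congr rfl fun t _ => ?_
  rw [Fintype.sum_sigma]
  exact Finset.sum_congr rfl fun k _ => Finset.sum_congr rfl fun i _ => (sq _).symm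

/-- Minkowski's inequality in squared form, by Cauchy–Schwarz on the cross term. The common factor
`K` will be `4ρ` times the input energy. -/
theorem sum_add_sq_le {ι : Type*} {s : Finset ι} {f g : ι → ℝ} {a b K : ℝ} (ha : 0 ≤ a)
    (hb : 0 ≤ b) (hK : 0 ≤ K) (hf : ∑ i ∈ s, f i ^ 2 ≤ K * a ^ 2)
    (hg : ∑ i ∈ s, g i ^ 2 ≤ K * b ^ 2) : ∑ i ∈ s, (f i + g i) ^ 2 ≤ K * (a + b) ^ 2 := by
  have h1 : (∑ i ∈ s, f i * g i) ^ 2 ≤ (K * (a * b)) ^ 2 := by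
    refine (Finset.sum_mul_sq_le_sq_mul_sq s f g).trans ?_
    refine (mul_le_mul hf hg (Finset.sum_nonneg fun i _ => sq_nonneg _) (by positivity)).trans_eq ?_
    ring
  have h2 := (le_abs_self _).trans (abs_le_of_sq_le_sq h1 (by positivity))
  have h3 : ∑ i ∈ s, (f i + g i) ^ 2 =
      ∑ i ∈ s, f i ^ 2 + 2 * ∑ i ∈ s, f i * g i + ∑ i ∈ s, g i ^ 2 := by
    rw [Finset.mul_sum, ← Finset.sum_add_distrib, ← Finset.sum_add_distrib]
    exact Finset.sum_congr rfl fun i _ => by ring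
  rw [h3]
  linarith

theorem horizonSqNorm_add_le {T : ℕ} {e e' : Signal m} {a b K : ℝ} (ha : 0 ≤ a) (hb : 0 ≤ b)
    (hK : 0 ≤ K) (he : horizonSqNorm T e ≤ K * a ^ 2) (he' : horizonSqNorm T e' ≤ K * b ^ 2) :
    horizonSqNorm T (e + e') ≤ K * (a + b) ^ 2 := by
  rw [horizonSqNorm_eq_sum] at *
  exact sum_add_sq_le ha hb hK he he'

/-- A bound on all finite horizons is a bound on the `ℓ₂`-norm. -/
theorem l2Norm_le_of_horizonSqNorm_le {e : Signal p} {u : Signal m} {K : ℝ} (hK : 0 ≤ K)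
    (h : ∀ T, horizonSqNorm T e ≤ K ^ 2 * horizonSqNorm T u) :
    l2Norm e ≤ ENNReal.ofReal K * l2Norm u := by
  have key : ∀ {m : V → ℕ → ℕ} (e : Signal m) (T : ℕ),
      ∑ t ∈ Finset.range T, ∑ k, ENNReal.ofReal (e k t ⬝ᵥ e k t) =
        ENNReal.ofReal (horizonSqNorm T e) := by
    intro m e T
    have h0 : ∀ k t, 0 ≤ e k t ⬝ᵥ e k t := fun k t => Finset.sum_nonneg fun _ _ => mul_self_nonneg _
    rw [horizonSqNorm, ENNReal.ofReal_sum_of_nonneg fun t _ => Finset.sum_nonneg fun k _ => h0 k t]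
    exact Finset.sum_congr rfl fun t _ => (ENNReal.ofReal_sum_of_nonneg fun k _ => h0 k t).symm
  have hsum : ∑' q : ℕ × V, ENNReal.ofReal (e q.2 q.1 ⬝ᵥ e q.2 q.1) ≤
      ENNReal.ofReal K ^ 2 * ∑' q : ℕ × V, ENNReal.ofReal (u q.2 q.1 ⬝ᵥ u q.2 q.1) := by
    rw [ENNReal.tsum_prod (f := fun t k => ENNReal.ofReal (e k t ⬝ᵥ e k t)),
      ENNReal.tsum_prod (f := fun t k => ENNReal.ofReal (u k t ⬝ᵥ u k t))]
    simp only [tsum_fintype]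
    refine ENNReal.tsum_le_of_sum_range_le fun T => ?_
    calc _ = ENNReal.ofReal (horizonSqNorm T e) := key e T
      _ ≤ ENNReal.ofReal (K ^ 2 * horizonSqNorm T u) := ENNReal.ofReal_le_ofReal (h T)
      _ = ENNReal.ofReal K ^ 2 * ∑ t ∈ Finset.range T, ∑ k, ENNReal.ofReal (u k t ⬝ᵥ u k t) := by
        rw [key u T, ENNReal.ofReal_mul (sq_nonneg K), ENNReal.ofReal_pow hK]
      _ ≤ _ := by
        gcongr
        exact ENNReal.sum_le_tsum _
  calc l2Norm e ≤ (ENNReal.ofReal K ^ 2 *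
        ∑' q : ℕ × V, ENNReal.ofReal (u q.2 q.1 ⬝ᵥ u q.2 q.1)) ^ (1 / 2 : ℝ) :=
        ENNReal.rpow_le_rpow hsum (by norm_num)
    _ = ENNReal.ofReal K * l2Norm u := by
        rw [ENNReal.mul_rpow_of_nonneg _ _ (by norm_num), ← ENNReal.rpow_natCast,
          ← ENNReal.rpow_mul]
        norm_num [l2Norm]

end FiniteHorizon

/-! ### Truncating one channel at a time -/

section ErrorBound

variable {V : Type*} [Fintype V] [DecidableEq V] {E : Finset (V × V)}
  {n : Channel E → ℕ → ℕ} {nu ny : V → ℕ → ℕ}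

/-- The entries that are kept if only the states in `S` are truncated. -/
def IsKept (r : Channel E → ℕ → ℕ) (S : Finset (Channel E)) (t : ℕ) (q : StateIdx n t) : Prop :=
  q.1 ∈ S → q.2.val < r q.1 t

instance (r : Channel E → ℕ → ℕ) (S : Finset (Channel E)) (t : ℕ) (q : StateIdx n t) :
    Decidable (IsKept r S t q) :=
  inferInstanceAs (Decidable (q.1 ∈ S → q.2.val < r q.1 t))

namespace DistSystem

/-- The output, without the feedthrough term, if only the states in `S` are truncated. -/
def partialOutput (G : DistSystem E n nu ny) (r : Channel E → ℕ → ℕ) (S : Finset (Channel E))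
    (u : Signal nu) : Signal ny := fun k t => G.readout t (G.maskedState (IsKept r S) u t) k

/-- Truncating one more state. -/
theorem horizonSqNorm_partialOutput_sub_insert_le (G : DistSystem E n nu ny) {X : GramianFamily n}
    {β ρ : ℝ} (hβ : 0 < β) (hρ0 : 0 ≤ ρ) (hρ : ρ ≤ 1) (hlow : ∀ t q, β ≤ gramianDiag X t q)
    (hobs : ∀ t (x : StateIdx n t → ℝ),
      ∑ q, gramianDiag X (t + 1) q * (G.next t x 0 q) ^ 2 +
          ∑ k, G.readout t x k ⬝ᵥ G.readout t x k ≤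
        ∑ q, gramianDiag X t q * x q ^ 2)
    (hctr : ∀ t (x : StateIdx n t → ℝ) (v : ∀ k, Fin (nu k t) → ℝ),
      ∑ q, (G.next t x v q) ^ 2 / gramianDiag X (t + 1) q ≤
        ρ * (∑ q, x q ^ 2 / gramianDiag X t q + ∑ k, v k ⬝ᵥ v k))
    (r : Channel E → ℕ → ℕ) (S : Finset (Channel E)) (c : Channel E) {w : ℕ → ℝ}
    (hw : ∀ t (i : Fin (n c t)), r c t ≤ i.val → t ∈ truncationTimes n r c ∧ X c t i i = w t)
    (hmono : MonotoneOn w (truncationTimes n r c) ∨ AntitoneOn w (truncationTimes n r c))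
    (hwβ : ∀ t ∈ truncationTimes n r c, β ≤ w t) {W : ℝ}
    (hwW : ∀ t ∈ truncationTimes n r c, w t ≤ W) (u : Signal nu) (T : ℕ) :
    horizonSqNorm T (G.partialOutput r S u - G.partialOutput r (insert c S) u) ≤
      4 * ρ * horizonSqNorm T u * W ^ 2 := by
  have hkept : ∀ t (q : StateIdx n t), IsKept r (insert c S) t q → IsKept r S t q :=
    fun t q h hq => h (Finset.mem_insert_of_mem hq)
  have hdiff : ∀ t (q : StateIdx n t), IsKept r S t q → ¬ IsKept r (insert c S) t q →
      t ∈ truncationTimes n r c ∧ gramianDiag X t q = w t := by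
    rintro t ⟨c', i⟩ h h'
    simp only [IsKept, Finset.mem_insert, Classical.not_imp, not_lt] at h h'
    rcases h' with ⟨rfl | hS, hi⟩
    · exact hw t i hi
    · exact absurd (h hS) (not_lt.2 hi)
  set x := G.maskedState (IsKept r S) u with hx
  set z := G.maskedState (IsKept r (insert c S)) u with hz
  -- The weights require `β ≤ W`, which only a truncation time provides; without one, the two masks
  -- coincide.
  rcases (truncationTimes n r c).eq_empty_or_nonempty with hF | ⟨t₀, ht₀⟩
  · have hxz : x = z := by
      have : IsKept (n := n) r S = IsKept r (insert c S) := by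
        funext t q
        refine propext ⟨fun h => ?_, hkept t q⟩
        by_contra h'
        have := (hdiff t q h h').1
        simp [hF] at this
      rw [hx, hz]
      congr!
    have h0 : G.partialOutput r S u - G.partialOutput r (insert c S) u = 0 := by
      unfold partialOutput
      rw [← hx, ← hz, hxz, sub_self]
    have h1 : horizonSqNorm T (0 : Signal ny) = 0 := by simp [horizonSqNorm]
    have := horizonSqNorm_nonneg T u
    rw [h0, h1]
    positivity
  · obtain ⟨a, b, a₀, ha₀, ha, hb, haa, hb0, hbW, hab⟩ :=
      exists_antitone_weights hmono hβ ((hwβ t₀ ht₀).trans (hwW t₀ ht₀)) hwβ hwW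
    have main := sum_mul_sq_error_le (σ := gramianDiag X) (fun t q => hβ.trans_le (hlow t q))
      (m := IsKept r S) (m' := IsKept r (insert c S)) hkept (x := x) (z := z)
      (X := fun t => G.next t (x t) fun k => u k t) (Z := fun t => G.next t (z t) fun k => u k t)
      rfl rfl (fun t q => rfl) (fun t q => rfl)
      (ε := fun t => ∑ k, (G.partialOutput r S u - G.partialOutput r (insert c S) u) k t ⬝ᵥ
        (G.partialOutput r S u - G.partialOutput r (insert c S) u) k t)
      (υ := fun t => ∑ k, u k t ⬝ᵥ u k t) hρ
      (fun t => by
        have h := hobs t (x t - z t)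
        have e := G.next_sub t (x t) (z t) (fun k => u k t) (fun k => u k t)
        rw [sub_self] at e
        rw [← e] at h
        simp only [readout_sub] at h
        exact h)
      (fun t => by
        -- The sum of the trajectories is driven by `2u`: this is the source of the factor `2` in
        -- the bound.
        have h := hctr t (x t + z t) ((fun k => u k t) + fun k => u k t)
        rw [← next_add] at h
        have e : ∑ k, ((fun k => u k t) + fun k => u k t : ∀ k, Fin (nu k t) → ℝ) k ⬝ᵥ
            ((fun k => u k t) + fun k => u k t : ∀ k, Fin (nu k t) → ℝ) k =
            4 * ∑ k, u k t ⬝ᵥ u k t := by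
          rw [Finset.mul_sum]
          refine Finset.sum_congr rfl fun k _ => ?_
          simp only [Pi.add_apply, dotProduct_add, add_dotProduct]
          ring
        rw [e] at h
        exact h)
      ha hb (fun t => ha₀.le.trans (haa t)) hb0
      (fun t q h h' => by
        rw [(hdiff t q h h').2]
        exact hab t (hdiff t q h h').1) T
    have h1 : a₀ * horizonSqNorm T (G.partialOutput r S u - G.partialOutput r (insert c S) u) ≤
        ∑ t ∈ Finset.range T, a (t + 1) *
          ∑ k, (G.partialOutput r S u - G.partialOutput r (insert c S) u) k t ⬝ᵥ
            (G.partialOutput r S u - G.partialOutput r (insert c S) u) k t := by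
      rw [horizonSqNorm, Finset.mul_sum]
      exact Finset.sum_le_sum fun t _ => mul_le_mul_of_nonneg_right (haa _)
        (Finset.sum_nonneg fun _ _ => Finset.sum_nonneg fun _ _ => mul_self_nonneg _)
    have h2 : ∑ t ∈ Finset.range T, b (t + 1) * ∑ k, u k t ⬝ᵥ u k t ≤
        a₀ * W ^ 2 * horizonSqNorm T u := by
      rw [horizonSqNorm, Finset.mul_sum]
      exact Finset.sum_le_sum fun t _ => mul_le_mul_of_nonneg_right (hbW _)
        (Finset.sum_nonneg fun _ _ => Finset.sum_nonneg fun _ _ => mul_self_nonneg _)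
    -- Both estimates carry the factor `a₀`, which cancels and leaves `W ^ 2`.
    have h3 := mul_le_mul_of_nonneg_left h2 (mul_nonneg zero_le_four hρ0 : 0 ≤ 4 * ρ)
    refine le_of_mul_le_mul_left ((h1.trans main).trans (h3.trans_eq ?_)) ha₀
    ring

/-- The output error on a finite horizon, with the slack of the strict inequalities. -/
theorem horizonSqNorm_output_sub_le {G : DistSystem E n nu ny} {X : GramianFamily n}
    {β ρ : ℝ} (hβ : 0 < β) (hρ0 : 0 ≤ ρ) (hρ : ρ ≤ 1) (hlow : ∀ t q, β ≤ gramianDiag X t q)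
    (hobs : ∀ t (x : StateIdx n t → ℝ),
      ∑ q, gramianDiag X (t + 1) q * (G.next t x 0 q) ^ 2 +
          ∑ k, G.readout t x k ⬝ᵥ G.readout t x k ≤
        ∑ q, gramianDiag X t q * x q ^ 2)
    (hctr : ∀ t (x : StateIdx n t → ℝ) (v : ∀ k, Fin (nu k t) → ℝ),
      ∑ q, (G.next t x v q) ^ 2 / gramianDiag X (t + 1) q ≤
        ρ * (∑ q, x q ^ 2 / gramianDiag X t q + ∑ k, v k ⬝ᵥ v k))
    {r : Channel E → ℕ → ℕ} (hr : ∀ c t, r c t ≤ n c t) {w : Channel E → ℕ → ℝ}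
    (hw : ∀ c t (i : Fin (n c t)), r c t ≤ i.val → t ∈ truncationTimes n r c ∧ X c t i i = w c t)
    (hmono : ∀ c, MonotoneOn (w c) (truncationTimes n r c) ∨
      AntitoneOn (w c) (truncationTimes n r c))
    (hwβ : ∀ c, ∀ t ∈ truncationTimes n r c, β ≤ w c t) {W : Channel E → ℝ} (hW : ∀ c, 0 ≤ W c)
    (hwW : ∀ c, ∀ t ∈ truncationTimes n r c, w c t ≤ W c) (u : Signal nu) (T : ℕ) :
    horizonSqNorm T (G.output u - (G.truncate r hr).output u) ≤
      4 * ρ * horizonSqNorm T u * (∑ c, W c) ^ 2 := by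
  have hind : ∀ S : Finset (Channel E),
      horizonSqNorm T (G.partialOutput r ∅ u - G.partialOutput r S u) ≤
        4 * ρ * horizonSqNorm T u * (∑ c ∈ S, W c) ^ 2 := by
    intro S
    induction S using Finset.induction_on with
    | empty => simp [horizonSqNorm]
    | insert c S hc ih =>
      have h := G.horizonSqNorm_partialOutput_sub_insert_le hβ hρ0 hρ hlow hobs hctr r S c (hw c)
        (hmono c) (hwβ c) (hwW c) u T
      have hu := horizonSqNorm_nonneg T u
      have h' := horizonSqNorm_add_le (Finset.sum_nonneg fun c _ => hW c) (hW c)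
        (by positivity) ih h
      rw [sub_add_sub_cancel] at h'
      rwa [Finset.sum_insert hc, add_comm]
  -- The feedthrough terms cancel, and the error runs from no truncated channel to all of them.
  have he : G.output u - (G.truncate r hr).output u =
      G.partialOutput r ∅ u - G.partialOutput r Finset.univ u := by
    funext k t
    simp only [Pi.sub_apply]
    rw [G.output_eq (IsKept r ∅) (fun t q h => by simp at h) u k t,
      G.truncate_output_eq hr (IsKept r Finset.univ) (fun t q => by simp [IsKept]) u k t,
      add_sub_add_right_eq_sub]
    rfl
  rw [he]
  exact hind _

end DistSystem

end ErrorBound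

/-! ### Suprema versus sums of distinct entries -/

section DistinctEntries

variable {V : Type*} {E : Finset (V × V)} {n : Channel E → ℕ → ℕ}

theorem truncationTimes_of_le {r : Channel E → ℕ → ℕ} {c : Channel E} {t : ℕ} {i : Fin (n c t)}
    (hi : r c t ≤ i.val) : t ∈ truncationTimes n r c := (hi.trans_lt i.2).ne'

theorem apply_eq_of_truncatedBlock_eq {X : GramianFamily n} {r : Channel E → ℕ → ℕ} {c : Channel E}
    {t : ℕ} {a : ℝ} (h : truncatedBlock X r c t = a • 1) {i : Fin (n c t)} (hi : r c t ≤ i.val) :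
    X c t i i = a := by
  simpa [truncatedBlock] using congrFun (congrFun h ⟨i, hi⟩) ⟨i, hi⟩

theorem exists_apply_eq_of_mem_truncationTimes {X : GramianFamily n} {r : Channel E → ℕ → ℕ}
    (hr : ∀ c t, r c t ≤ n c t) {c : Channel E} {t : ℕ} (ht : t ∈ truncationTimes n r c) {a : ℝ}
    (h : truncatedBlock X r c t = a • 1) : ∃ i : Fin (n c t), r c t ≤ i.val ∧ X c t i i = a :=
  ⟨⟨r c t, lt_of_le_of_ne (hr c t) (Ne.symm ht)⟩, le_rfl, apply_eq_of_truncatedBlock_eq h le_rfl⟩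

theorem truncatedEntries_eq_iUnion {X : GramianFamily n} {r : Channel E → ℕ → ℕ}
    (hr : ∀ c t, r c t ≤ n c t) {w : Channel E → ℕ → ℝ}
    (hw : ∀ c, ∀ t ∈ truncationTimes n r c, truncatedBlock X r c t = w c t • 1) :
    truncatedEntries X r = ⋃ c, w c '' truncationTimes n r c := by
  ext a
  simp only [truncatedEntries, Set.mem_ofPred_eq, Set.mem_iUnion, Set.mem_image]
  constructor
  · rintro ⟨c, t, ⟨i, hi⟩, rfl⟩
    have ht := truncationTimes_of_le hi
    exact ⟨c, t, ht, (apply_eq_of_truncatedBlock_eq (hw c t ht) hi).symm⟩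
  · rintro ⟨c, t, ht, rfl⟩
    obtain ⟨i, hi, h⟩ := exists_apply_eq_of_mem_truncationTimes hr ht (hw c t ht)
    exact ⟨c, t, ⟨i, hi⟩, h⟩

theorem distinctEntriesSum_eq_sum [Fintype V] {X : GramianFamily n}
    {r : Channel E → ℕ → ℕ} (hr : ∀ c t, r c t ≤ n c t) {w : Channel E → ℕ → ℝ}
    (hw : ∀ c, ∀ t ∈ truncationTimes n r c, truncatedBlock X r c t = w c t • 1)
    (hdisj : ∀ c c', c ≠ c' → ∀ t ∈ truncationTimes n r c, ∀ t' ∈ truncationTimes n r c',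
      w c t ≠ w c' t') :
    distinctEntriesSum X r = ∑ c, ∑' a : (w c '' truncationTimes n r c), ENNReal.ofReal a := by
  rw [distinctEntriesSum, truncatedEntries_eq_iUnion hr hw, ← tsum_fintype (L := .unconditional _)]
  refine ENNReal.tsum_biUnion (f := ENNReal.ofReal) ?_
  rintro c - c' - hc
  refine Set.disjoint_left.2 ?_
  rintro _ ⟨t, ht, rfl⟩ ⟨t', ht', h⟩
  exact hdisj c c' hc t ht t' ht' h.symm

theorem iSup_ofReal_le_tsum_image (w : ℕ → ℝ) (F : Set ℕ) :
    ⨆ t ∈ F, ENNReal.ofReal (w t) ≤ ∑' a : (w '' F), ENNReal.ofReal a :=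
  iSup₂_le fun t ht => ENNReal.le_tsum (f := fun a : (w '' F) => ENNReal.ofReal a)
    ⟨w t, t, ht, rfl⟩

/-- Every value has a different companion value of size at least `β`, so the sum exceeds each value
by `β`. This uniform gap survives the supremum, which is finite. -/
theorem iSup_ofReal_lt_tsum_image {w : ℕ → ℝ} {F : Set ℕ} {β : ℝ} (hβ : 0 < β)
    (hw : ∀ t ∈ F, β ≤ w t) (hfin : ⨆ t ∈ F, ENNReal.ofReal (w t) ≠ ∞)
    (hne : ∃ t ∈ F, ∃ t' ∈ F, w t ≠ w t') :
    ⨆ t ∈ F, ENNReal.ofReal (w t) < ∑' a : (w '' F), ENNReal.ofReal a := by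
  obtain ⟨t₁, h₁, t₂, h₂, h₁₂⟩ := hne
  have key : ∀ t ∈ F, ENNReal.ofReal (w t) + ENNReal.ofReal β ≤
      ∑' a : (w '' F), ENNReal.ofReal a := by
    intro t ht
    obtain ⟨s, hs, hts⟩ : ∃ s ∈ F, w t ≠ w s := by
      by_cases h : w t = w t₁
      · exact ⟨t₂, h₂, h ▸ h₁₂⟩
      · exact ⟨t₁, h₁, h⟩
    have hne' : (⟨w t, t, ht, rfl⟩ : (w '' F)) ≠ ⟨w s, s, hs, rfl⟩ :=
      fun h => hts (congrArg Subtype.val h)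
    have := ENNReal.sum_le_tsum (f := fun a : (w '' F) => ENNReal.ofReal a)
      {⟨w t, t, ht, rfl⟩, ⟨w s, s, hs, rfl⟩}
    rw [Finset.sum_pair hne'] at this
    exact (add_le_add le_rfl (ENNReal.ofReal_le_ofReal (hw s hs))).trans this
  calc ⨆ t ∈ F, ENNReal.ofReal (w t) < (⨆ t ∈ F, ENNReal.ofReal (w t)) + ENNReal.ofReal β :=
        ENNReal.lt_add_right hfin (ENNReal.ofReal_pos.2 hβ).ne'
    _ ≤ _ := by
        rw [ENNReal.biSup_add ⟨t₁, h₁⟩]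
        exact iSup₂_le key

end DistinctEntries

/-! ### Assembly of the bounds -/

theorem mainTheorem3 {V : Type*} [Fintype V] [DecidableEq V] {E : Finset (V × V)}
    {n : Channel E → ℕ → ℕ} {nu ny : V → ℕ → ℕ}
    (G : DistSystem E n nu ny) (hG : G.IsUniformlyBounded)
    (X : GramianFamily n) (hX : G.IsBalancedGramian X)
    (r : Channel E → ℕ → ℕ) (hr : ∀ c t, r c t ≤ n c t)
    (htrunc : ∃ c, (truncationTimes n r c).Nonempty)
    (w : Channel E → ℕ → ℝ)
    (hw : ∀ c, ∀ t ∈ truncationTimes n r c, truncatedBlock X r c t = w c t • 1)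
    (hmono : ∀ c, MonotoneOn (w c) (truncationTimes n r c) ∨
      AntitoneOn (w c) (truncationTimes n r c)) :
    inducedNorm (fun u => G.output u - (G.truncate r hr).output u) <
      2 * ((∑ k : V, ⨆ t ∈ truncationTimes n r (Sum.inl k), ENNReal.ofReal (w (Sum.inl k) t)) +
        ∑ e : E, ⨆ t ∈ truncationTimes n r (Sum.inr e), ENNReal.ofReal (w (Sum.inr e) t)) ∧
    ((∀ c c', c ≠ c' → ∀ t ∈ truncationTimes n r c, ∀ t' ∈ truncationTimes n r c',
        w c t ≠ w c' t') →
      2 * ((∑ k : V, ⨆ t ∈ truncationTimes n r (Sum.inl k), ENNReal.ofReal (w (Sum.inl k) t)) +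
        ∑ e : E, ⨆ t ∈ truncationTimes n r (Sum.inr e), ENNReal.ofReal (w (Sum.inr e) t)) ≤
          2 * distinctEntriesSum X r ∧
      ((∃ c, ∃ t ∈ truncationTimes n r c, ∃ t' ∈ truncationTimes n r c, w c t ≠ w c t') →
        2 * ((∑ k : V, ⨆ t ∈ truncationTimes n r (Sum.inl k), ENNReal.ofReal (w (Sum.inl k) t)) +
          ∑ e : E, ⨆ t ∈ truncationTimes n r (Sum.inr e), ENNReal.ofReal (w (Sum.inr e) t)) <
            2 * distinctEntriesSum X r)) := by
  obtain ⟨β, M, ρ, hβ, hρ0, hρ1, hlow, hup, hobs, hctr⟩ := hX.exists_dissipation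
  have hentry : ∀ c, ∀ t ∈ truncationTimes n r c, β ≤ w c t ∧ w c t ≤ M := by
    intro c t ht
    obtain ⟨i, -, h⟩ := exists_apply_eq_of_mem_truncationTimes hr ht (hw c t ht)
    rw [← h]
    exact ⟨hlow t ⟨c, i⟩, hup t ⟨c, i⟩⟩
  set s : Channel E → ℝ≥0∞ := fun c => ⨆ t ∈ truncationTimes n r c, ENNReal.ofReal (w c t)
  have hsfin : ∀ c, s c ≠ ∞ := fun c => ne_top_of_le_ne_top ENNReal.ofReal_ne_top
    (iSup₂_le fun t ht => ENNReal.ofReal_le_ofReal (hentry c t ht).2)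
  have hws : ∀ c, ∀ t ∈ truncationTimes n r c, ENNReal.ofReal (w c t) ≤ s c := fun c t ht =>
    le_iSup₂ (f := fun t (_ : t ∈ truncationTimes n r c) => ENNReal.ofReal (w c t)) t ht
  have hsplit : (∑ k : V, s (Sum.inl k)) + ∑ e : E, s (Sum.inr e) = ∑ c, s c :=
    (Fintype.sum_sum_type s).symm
  change _ < 2 * ((∑ k : V, s (Sum.inl k)) + ∑ e : E, s (Sum.inr e)) ∧
    (_ → 2 * ((∑ k : V, s (Sum.inl k)) + ∑ e : E, s (Sum.inr e)) ≤ _ ∧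
      (_ → 2 * ((∑ k : V, s (Sum.inl k)) + ∑ e : E, s (Sum.inr e)) < _))
  rw [hsplit]
  refine ⟨?_, fun hdisj => ⟨?_, ?_⟩⟩
  · set W : ℝ := ∑ c, (s c).toReal with hW
    have hWs : ENNReal.ofReal W = ∑ c, s c := by
      rw [hW, ENNReal.ofReal_sum_of_nonneg fun c _ => ENNReal.toReal_nonneg]
      exact Finset.sum_congr rfl fun c _ => ENNReal.ofReal_toReal (hsfin c)
    -- A truncated entry makes `W` positive; otherwise `√ρ < 1` would give no strict inequality.
    have hW0 : 0 < W := by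
      obtain ⟨c, t, ht⟩ := htrunc
      rw [← ENNReal.ofReal_pos, hWs]
      exact ((ENNReal.ofReal_pos.2 (hβ.trans_le (hentry c t ht).1)).trans_le (hws c t ht)).trans_le
        (Finset.single_le_sum (fun c _ => zero_le) (Finset.mem_univ c))
    have hsqrt : √ρ < 1 := by rwa [Real.sqrt_lt' one_pos, one_pow]
    have hle : inducedNorm (fun u => G.output u - (G.truncate r hr).output u) ≤
        ENNReal.ofReal (2 * √ρ * W) := by
      refine iSup_le fun u => iSup_le fun _ => iSup_le fun _ => ENNReal.div_le_of_le_mul ?_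
      refine l2Norm_le_of_horizonSqNorm_le (by positivity) fun T => ?_
      refine (DistSystem.horizonSqNorm_output_sub_le hβ hρ0 hρ1.le hlow hobs hctr hr
        (fun c t i hi => ?_) hmono (fun c t ht => (hentry c t ht).1)
        (W := fun c => (s c).toReal) (fun c => ENNReal.toReal_nonneg) (fun c t ht => ?_) u T).trans_eq ?_
      · exact ⟨truncationTimes_of_le hi,
          apply_eq_of_truncatedBlock_eq (hw c t (truncationTimes_of_le hi)) hi⟩
      · exact (ENNReal.ofReal_le_iff_le_toReal (hsfin c)).1 (hws c t ht)
      · rw [mul_pow, mul_pow, Real.sq_sqrt hρ0]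
        ring
    refine hle.trans_lt ?_
    rw [← hWs, show (2 : ℝ≥0∞) = ENNReal.ofReal 2 by simp, ← ENNReal.ofReal_mul zero_le_two]
    refine (ENNReal.ofReal_lt_ofReal_iff (by positivity)).2 ?_
    nlinarith
  · rw [distinctEntriesSum_eq_sum hr hw hdisj]
    gcongr
    exact iSup_ofReal_le_tsum_image _ _
  · rintro ⟨c, hc⟩
    rw [distinctEntriesSum_eq_sum hr hw hdisj]
    refine (ENNReal.mul_lt_mul_iff_right two_ne_zero ENNReal.ofNat_ne_top).2 ?_
    -- The nonconstant channel is split off. Strictness survives addition because the remaining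
    -- suprema have a finite sum, even if the sum of distinct entries is infinite.
    rw [← Finset.add_sum_erase _ _ (Finset.mem_univ c), ← Finset.add_sum_erase
      (a := c) _ (fun c => ∑' a : (w c '' truncationTimes n r c), ENNReal.ofReal a)
      (Finset.mem_univ c)]
    refine ENNReal.add_lt_add_of_lt_of_le (ENNReal.sum_ne_top.2 fun c _ => hsfin c)
      (iSup_ofReal_lt_tsum_image hβ (fun t ht => (hentry c t ht).1) (hsfin c) hc) ?_
    exact Finset.sum_le_sum fun c _ => iSup_ofReal_le_tsum_image _ _
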